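/- Let $m\ge 1$ and $N\ge 0$ be integers and let $p\in[1,\infty]$. An entire function $F:\mathbb C^m\to\mathbb C$ is of spherical type $1$ if for every $\varepsilon>0$ there is a constant $C(\varepsilon,F)$ with $|F(z)|\le C(\varepsilon,F)\exp((1+\varepsilon)|z|)$ for all $z\in\mathbb C^m$, where $|z|=\big(\sum_{j}|z_j|^2\big)^{1/2}$. Let $E_{1,m}$ be the set of restrictions to $\mathbb R^m$ of such functions, and let $E_{1,1,e}$ be the set of restrictions to $\mathbb R$ of the even entire functions of type $1$ on $\mathbb C$. Let $\Delta$ be the Laplace operator on $\mathbb R^m$, and let $Be_\nu(\varphi)(r)=\varphi''(r)+\frac{2\nu+1}{r}\varphi'(r)$ be the Bessel operator, with $Be_\nu(\varphi)(0):=\lim_{r\to0}Be_\nu(\varphi)(r)$; $\Delta^N$ and $(Be_\nu)^N$ denote $N$-fold iterates (the identity for $N=0$). Let $L_{p,|t|^{m-1}}(\mathbb R)$ be the space of measurable $g:\mathbb R\to\mathbb C$ with finite norm $\big(\int_{\mathbb R}|g(t)|^p|t|^{m-1}\,dt\big)^{1/p}$ (the essential supremum of $|g|$ if $p=\infty$).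 Let $|S^{m-1}|$ be the surface measure of the unit sphere of $\mathbb R^m$ (so $|S^0|=2$). Then, with suprema taken in $[0,\infty]$ and $1/p:=0$ for $p=\infty$, $$\sup_{f\in (E_{1,m}\cap L_p(\mathbb R^m))\setminus\{0\}}\frac{|\Delta^N f(0)|}{\|f\|_{L_p(\mathbb R^m)}}=\left(\frac{2}{|S^{m-1}|}\right)^{1/p}\sup_{g\in (E_{1,1,e}\cap L_{p,|t|^{m-1}}(\mathbb R))\setminus\{0\}}\frac{|(Be_{m/2-1})^N g(0)|}{\|g\|_{L_{p,|t|^{m-1}}(\mathbb R)}}.$$ -/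

import Mathlib

open MeasureTheory Filter Topology
open scoped ENNReal Laplacian

/-- `F : V → ℂ` is an entire function of (spherical) exponential type `σ`:
`|F z| ≤ C(ε, F) exp (σ (1 + ε) |z|)` for every `ε > 0`. It is used for `V = ℂ^m` with its
Hermitian norm and for `V = ℂ`. -/
def IsEntireOfType {V : Type*} [NormedAddCommGroup V] [NormedSpace ℂ V] (σ : ℝ) (F : V → ℂ) :
    Prop :=
  Differentiable ℂ F ∧
    ∀ ε : ℝ, 0 < ε → ∃ C : ℝ, ∀ z : V, ‖F z‖ ≤ C * Real.exp (σ * (1 + ε) * ‖z‖)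

/-- The inclusion of `ℝ^m` into `ℂ^m`. -/
def complexify {m : ℕ} (x : EuclideanSpace ℝ (Fin m)) : EuclideanSpace ℂ (Fin m) :=
  WithLp.toLp 2 (fun i => (x i : ℂ))

/-- `E_{σ,m}`: the restrictions to `ℝ^m` of the entire functions on `ℂ^m` of spherical
type `σ`. -/
def sphericalTypeClass (σ : ℝ) (m : ℕ) : Set (EuclideanSpace ℝ (Fin m) → ℂ) :=
  {f | ∃ F : EuclideanSpace ℂ (Fin m) → ℂ,
    IsEntireOfType σ F ∧ ∀ x, f x = F (complexify x)}

/-- `E_{σ,1,e}`: the restrictions to `ℝ` of the even entire functions on `ℂ` of exponential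
type `σ`. -/
def evenTypeClass (σ : ℝ) : Set (ℝ → ℂ) :=
  {g | ∃ G : ℂ → ℂ, IsEntireOfType σ G ∧ (∀ z, G (-z) = G z) ∧ ∀ t : ℝ, g t = G (t : ℂ)}

/-- The measure `|t|^k dt` on `ℝ`. It has the same null sets as Lebesgue measure, so the essential
supremum with respect to it is the usual one. -/
noncomputable def powerWeight (k : ℕ) : Measure ℝ :=
  volume.withDensity (fun t => ENNReal.ofReal (|t| ^ k))

/-- The complex functions on `X` that lie in `L_p(X, μ)`. -/
def lpClass {X : Type*} [MeasurableSpace X] (p : ℝ≥0∞) (μ : Measure X) : Set (X → ℂ) :=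
  {f | MemLp f p μ}

/-- The Bessel operator `Be_ν φ (r) = φ''(r) + ((2ν+1)/r) φ'(r)`, whose value at `r = 0` is the
limit of this expression as `r → 0`. -/
noncomputable def besselOp (ν : ℝ) (φ : ℝ → ℂ) : ℝ → ℂ :=
  let b : ℝ → ℂ := fun r => deriv (deriv φ) r + ((2 * ν + 1) / r) • deriv φ r
  fun r => if r = 0 then limUnder (𝓝[≠] (0 : ℝ)) b else b r

/-- The sharp constant `sup_{f ∈ B \ {0}} |D(f)(a)| / ‖f‖_{L_p(X, μ)}`, as an element of `[0, ∞]`. -/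
noncomputable def sharpConstant {X : Type*} [MeasurableSpace X] (B : Set (X → ℂ)) (p : ℝ≥0∞)
    (μ : Measure X) (D : (X → ℂ) → (X → ℂ)) (a : X) : ℝ≥0∞ :=
  ⨆ f ∈ B \ {0}, ‖D f a‖ₑ / eLpNorm f p μ

/-- The surface measure `|S^{m-1}|` of the unit sphere of `ℝ^m` (equal to `2` for `m = 1`). -/
noncomputable def sphereArea (m : ℕ) : ℝ≥0∞ :=
  (volume : Measure (EuclideanSpace ℝ (Fin m))).toSphere Set.univ

/-!
Radial functions on `ℝ^m` correspond to even functions on the line, and spherical averaging shows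
that nothing is lost by restricting the extremal problem to radial functions.

For a smooth `f` let `M f (t)` be the mean of `f(t u)` over the unit sphere (`sphereMean`). Darboux's
equation, in the form `Be_{m/2-1} (M f) = M (Δ f)` (`besselOp_sphereMean`), holds including at the
origin, and since `M f (0) = f(0)`, iteration gives `Be^N (M f) (0) = Δ^N f (0)`
(`iterate_besselOp_sphereMean_zero`). Darboux's equation is obtained by testing against radial
functions, where it reduces to Green's identity on the space and an integration by parts in the
radius (`sq_mul_sphereMean_laplacian`).

Given `f` of spherical type `1`, the mean `g = M f` extends to the even entire function
`z ↦ ⨍ F(z u) du` of type `1`, and `‖g‖ ≤ (2 / |S^{m-1}|)^{1/p} ‖f‖` by Jensen's inequality and polar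
coordinates (`eLpNorm_sphereMean_le`). This bounds the left side by the right one. Conversely, an
even entire function is an entire function of `z²` (`exists_entire_comp_sq`), so an even `g` of type
`1` has the radial extension `f(x) = g(|x|)`, which is of spherical type `1`
(`comp_norm_mem_sphericalTypeClass`), satisfies `M f = g`, and has the norm of `g` up to the same
constant (`eLpNorm_comp_norm`).

The smoothness used in all this comes from the fact that complex Fréchet differentiable functions of
several variables are smooth (`contDiff_infty_of_entire`).
-/

/-! ### Entire functions of several variables are smooth -/

section EntireSmooth

variable {V : Type*} [NormedAddCommGroup V] [NormedSpace ℂ V]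

lemma deriv_comp_add_smul {F : V → ℂ} (hF : Differentiable ℂ F) (z v : V) :
    deriv (fun ζ : ℂ => F (z + ζ • v)) 0 = fderiv ℂ F z v := by
  have hline : HasDerivAt (fun ζ : ℂ => z + ζ • v) v 0 := by
    simpa using ((hasDerivAt_id (0 : ℂ)).smul_const v).const_add z
  have h := (hF (z + (0 : ℂ) • v)).hasFDerivAt.comp_hasDerivAt (0 : ℂ) hline
  simpa [Function.comp_def] using h.deriv

/-- Cauchy's estimate in every complex direction. -/
lemma norm_fderiv_le_of_forall_closedBall_norm_le {F : V → ℂ} (hF : Differentiable ℂ F)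
    {z : V} {M : ℝ} (hM : ∀ w ∈ Metric.closedBall z 1, ‖F w‖ ≤ M) : ‖fderiv ℂ F z‖ ≤ M := by
  have hM0 : 0 ≤ M := (norm_nonneg _).trans (hM z (Metric.mem_closedBall_self zero_le_one))
  refine ContinuousLinearMap.opNorm_le_bound _ hM0 fun v => ?_
  rcases eq_or_ne v 0 with rfl | hv
  · simp
  have hv' : 0 < ‖v‖ := norm_pos_iff.2 hv
  have hd : Differentiable ℂ fun ζ : ℂ => F (z + ζ • v) := by fun_prop
  have hb : ∀ ζ ∈ Metric.sphere (0 : ℂ) ‖v‖⁻¹, ‖F (z + ζ • v)‖ ≤ M := by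
    intro ζ hζ
    refine hM _ ?_
    have : ‖ζ‖ = ‖v‖⁻¹ := by simpa using hζ
    simp [norm_smul, this, hv'.ne']
  have := Complex.norm_deriv_le_of_forall_mem_sphere_norm_le (inv_pos.2 hv')
    hd.diffContOnCl hb
  rwa [deriv_comp_add_smul hF, div_inv_eq_mul] at this

lemma exists_norm_fderiv_le_of_entire [FiniteDimensional ℂ V] {F : V → ℂ}
    (hF : Differentiable ℂ F) (R : ℝ) : ∃ M, ∀ z : V, ‖z‖ ≤ R → ‖fderiv ℂ F z‖ ≤ M := by
  have : ProperSpace V := FiniteDimensional.proper ℂ V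
  obtain ⟨M, hM⟩ := (isCompact_closedBall (0 : V) (R + 1)).exists_bound_of_continuousOn
    hF.continuous.continuousOn
  refine ⟨M, fun z hz => norm_fderiv_le_of_forall_closedBall_norm_le hF fun w hw => hM w ?_⟩
  rw [mem_closedBall_iff_norm] at hw
  rw [mem_closedBall_zero_iff]
  linarith [norm_le_insert z w, norm_sub_rev z w, norm_sub_norm_le w z]

/-- Directional derivatives of entire functions are entire: Cauchy's formula in the direction `v`
writes the derivative as a circle integral, which can be differentiated in the base point. -/
lemma differentiable_fderiv_apply_of_entire [FiniteDimensional ℂ V] {F : V → ℂ}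
    (hF : Differentiable ℂ F) (v : V) : Differentiable ℂ fun z => fderiv ℂ F z v := by
  borelize V
  have : ProperSpace V := FiniteDimensional.proper ℂ V
  set c : ℝ → ℂ := fun θ => deriv (circleMap 0 1) θ * (circleMap 0 1 θ ^ 2)⁻¹ with hc
  set γ : ℝ → V := fun θ => circleMap 0 1 θ • v with hγ
  have hγc : Continuous γ := by fun_prop
  have hne : ∀ θ : ℝ, circleMap 0 1 θ ≠ 0 := fun θ => circleMap_ne_center one_ne_zero
  have hcc : Continuous c := by
    simp only [hc, deriv_circleMap]
    exact Continuous.mul (by fun_prop)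
      (Continuous.inv₀ (by fun_prop) fun θ => pow_ne_zero _ (hne θ))
  have hcn : ∀ θ, ‖c θ‖ = 1 := fun θ => by simp [hc, deriv_circleMap]
  have hγn : ∀ θ, ‖γ θ‖ = ‖v‖ := fun θ => by simp [hγ, norm_smul]
  have key : ∀ z, fderiv ℂ F z v =
      (2 * Real.pi * Complex.I : ℂ)⁻¹ * ∫ θ in (0 : ℝ)..2 * Real.pi, c θ * F (z + γ θ) := by
    intro z
    have hd : Differentiable ℂ fun ζ : ℂ => F (z + ζ • v) := by fun_prop
    have h1 :=
      (hd.differentiableOn (s := Metric.closedBall 0 1)).deriv_eq_smul_circleIntegral one_pos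
    rw [deriv_comp_add_smul hF, eq_comm, smul_eq_mul] at h1
    rw [eq_inv_mul_iff_mul_eq₀ Complex.two_pi_I_ne_zero, h1]
    simp only [circleIntegral, sub_zero, smul_eq_mul, hc, hγ]
    congr 1
    funext θ
    rw [one_div, mul_assoc]
  rw [funext key]
  intro z₀
  obtain ⟨M, hM⟩ := exists_norm_fderiv_le_of_entire hF (‖z₀‖ + 1 + ‖v‖)
  have hder := intervalIntegral.hasFDerivAt_integral_of_dominated_of_fderiv_le (𝕜 := ℂ)
    (μ := volume) (a := 0) (b := 2 * Real.pi) (s := Metric.ball z₀ 1)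
    (F := fun z θ => c θ * F (z + γ θ)) (F' := fun z θ => c θ • fderiv ℂ F (z + γ θ))
    (bound := fun _ => M) (x₀ := z₀) (Metric.ball_mem_nhds _ one_pos)
    (Eventually.of_forall fun z => (Continuous.aestronglyMeasurable
      (hcc.mul (hF.continuous.comp (continuous_const.add hγc)))))
    (Continuous.intervalIntegrable
      (hcc.mul (hF.continuous.comp (continuous_const.add hγc))) _ _)
    (hcc.aestronglyMeasurable.smul ((measurable_fderiv ℂ F).comp
      (continuous_const.add hγc).measurable).aestronglyMeasurable)
    (Eventually.of_forall fun θ _ z hz => by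
      rw [norm_smul, hcn, one_mul]
      refine hM _ ?_
      rw [mem_ball_iff_norm] at hz
      have h1 := norm_add_le z (γ θ)
      rw [hγn] at h1
      linarith [norm_sub_norm_le z z₀])
    intervalIntegrable_const
    (Eventually.of_forall fun θ _ z _ => by
      have h := (hF (z + γ θ)).hasFDerivAt.comp z ((hasFDerivAt_id (𝕜 := ℂ) z).add_const (γ θ))
      exact h.const_smul (c θ))
  exact (hder.differentiableAt).const_mul _

lemma contDiff_of_entire [FiniteDimensional ℂ V] (n : ℕ) {F : V → ℂ}
    (hF : Differentiable ℂ F) : ContDiff ℂ n F := by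
  induction n generalizing F with
  | zero => exact contDiff_zero.2 hF.continuous
  | succ n ih =>
    push_cast
    refine contDiff_succ_iff_fderiv_apply.2 ⟨hF, by simp, fun v => ?_⟩
    exact ih (differentiable_fderiv_apply_of_entire hF v)

open scoped ContDiff in
/-- Fréchet differentiability over `ℂ` alone gives smoothness, also in several variables. -/
lemma contDiff_infty_of_entire [FiniteDimensional ℂ V] {F : V → ℂ}
    (hF : Differentiable ℂ F) : ContDiff ℂ ∞ F :=
  contDiff_infty.2 fun n => contDiff_of_entire n hF

end EntireSmooth

/-! ### Differentiation of integrals over compact spaces -/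

/-- Differentiation under the integral sign over a compact parameter space. -/
lemma hasDerivAt_integral_of_compactSpace {𝕜 K : Type*} [RCLike 𝕜] [TopologicalSpace K]
    [CompactSpace K] [MeasurableSpace K] [OpensMeasurableSpace K]
    (μ : Measure K) [IsFiniteMeasure μ] [NormedSpace 𝕜 ℂ] {F F' : 𝕜 → K → ℂ}
    (hF : Continuous (Function.uncurry F)) (hF' : Continuous (Function.uncurry F'))
    (h : ∀ z k, HasDerivAt (fun z => F z k) (F' z k) z) (z : 𝕜) :
    HasDerivAt (fun z => ∫ k, F z k ∂μ) (∫ k, F' z k ∂μ) z := by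
  obtain ⟨M, hM⟩ := ((isCompact_closedBall z 1).prod
    (isCompact_univ (X := K))).exists_bound_of_continuousOn hF'.continuousOn
  have hm : ∀ {g : K → ℂ}, Continuous g → AEStronglyMeasurable g μ := fun hg =>
    (hg.stronglyMeasurable_of_hasCompactSupport
      (HasCompactSupport.of_compactSpace _)).aestronglyMeasurable
  have hint : ∀ {g : K → ℂ}, Continuous g → Integrable g μ := fun {g} hg => by
    obtain ⟨C, hC⟩ := (isCompact_univ (X := K)).exists_bound_of_continuousOn hg.continuousOn
    exact Integrable.of_bound (hm hg) C (Eventually.of_forall fun k => hC k trivial)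
  refine (hasDerivAt_integral_of_dominated_loc_of_deriv_le (bound := fun _ => M)
    (Metric.closedBall_mem_nhds z one_pos)
    (Eventually.of_forall fun w => hm (by fun_prop)) (hint (by fun_prop)) (hm (by fun_prop))
    (Eventually.of_forall fun k w hw => hM (w, k) ⟨hw, trivial⟩) (integrable_const _)
    (Eventually.of_forall fun k w _ => h w k)).2

/-! ### The Euler vector field -/

section Euler

variable {E : Type*} [NormedAddCommGroup E] [InnerProductSpace ℝ E]

/-- The derivative of `f` along the Euler vector field `x ↦ x`. -/
noncomputable def eulerDeriv (f : E → ℂ) (x : E) : ℂ := fderiv ℝ f x x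

open scoped ContDiff in
lemma ContDiff.eulerDeriv {f : E → ℂ} (hf : ContDiff ℝ ∞ f) : ContDiff ℝ ∞ (eulerDeriv f) := by
  have : ContDiff ℝ ∞ (fderiv ℝ f) := hf.fderiv_right (by simp)
  exact this.clm_apply contDiff_id

end Euler

/-! ### Spherical means and polar coordinates -/

section SphericalMean

variable {E : Type*} [NormedAddCommGroup E] [InnerProductSpace ℝ E] [FiniteDimensional ℝ E]
  [MeasurableSpace E] [BorelSpace E]

open Metric in
/-- The mean of `f` over the sphere of radius `|t|` about the origin, taken over the points `t • u`
with `u` on the unit sphere, so that the radius `t` may be any real number. -/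
noncomputable def sphereMean (f : E → ℂ) (t : ℝ) : ℂ :=
  ⨍ u : sphere (0 : E) 1, f (t • (u : E)) ∂(volume : Measure E).toSphere

open Metric Set Pointwise in
lemma measurePreserving_neg_toSphere :
    MeasurePreserving (fun u : sphere (0 : E) 1 => -u) (volume : Measure E).toSphere
      (volume : Measure E).toSphere := by
  refine ⟨measurable_neg, Measure.ext fun s hs => ?_⟩
  rw [Measure.map_apply measurable_neg hs, Measure.toSphere_apply' _ hs,
    Measure.toSphere_apply' _ (measurable_neg hs)]
  congr 1
  have : Ioo (0 : ℝ) 1 • ((↑) '' ((fun u : sphere (0 : E) 1 => -u) ⁻¹' s) : Set E) =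
      -(Ioo (0 : ℝ) 1 • ((↑) '' s : Set E)) := by
    ext x
    simp only [Set.mem_smul, Set.mem_image, Set.mem_preimage, Set.mem_neg]
    constructor
    · rintro ⟨r, hr, _, ⟨u, hu, rfl⟩, rfl⟩
      exact ⟨r, hr, _, ⟨-u, hu, rfl⟩, by simp⟩
    · rintro ⟨r, hr, _, ⟨u, hu, rfl⟩, h⟩
      refine ⟨r, hr, _, ⟨-u, by simpa using hu, rfl⟩, ?_⟩
      rw [← neg_eq_iff_eq_neg.2 h.symm.symm]
      simp
  rw [this, Measure.measure_neg]

lemma sphereMean_eq_smul_integral (f : E → ℂ) :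
    sphereMean f = ((volume : Measure E).toSphere.real Set.univ)⁻¹ • fun t =>
      ∫ u : Metric.sphere (0 : E) 1, f (t • (u : E)) ∂(volume : Measure E).toSphere :=
  funext fun _ => average_eq _ _

lemma sphereMean_neg (f : E → ℂ) (t : ℝ) : sphereMean f (-t) = sphereMean f t := by
  have h := (measurePreserving_neg_toSphere (E := E)).integral_comp
    (Homeomorph.neg (Metric.sphere (0 : E) 1)).measurableEmbedding (fun u => f (t • (u : E)))
  rw [sphereMean, sphereMean, average_eq, average_eq, ← h]
  simp

lemma sphereMean_zero [Nontrivial E] (f : E → ℂ) : sphereMean f 0 = f 0 := by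
  have : NeZero (volume : Measure E).toSphere := ⟨Measure.toSphere_ne_zero _⟩
  simp only [sphereMean, zero_smul]
  exact average_const _ _

lemma continuous_sphereMean {f : E → ℂ} (hf : Continuous f) : Continuous (sphereMean f) := by
  have h := continuous_parametric_integral_of_continuous (μ := (volume : Measure E).toSphere)
    (f := fun (t : ℝ) (u : Metric.sphere (0 : E) 1) => f (t • (u : E)))
    (by fun_prop) isCompact_univ
  rw [Measure.restrict_univ] at h
  rw [sphereMean_eq_smul_integral]
  exact h.const_smul _

open scoped ContDiff in
/-- The Euler derivative acts on spherical means as `t d/dt`. -/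
lemma hasDerivAt_sphereMean {f : E → ℂ} (hf : ContDiff ℝ ∞ f) {t : ℝ} (ht : t ≠ 0) :
    HasDerivAt (sphereMean f) ((t : ℂ)⁻¹ * sphereMean (eulerDeriv f) t) t := by
  have hf' : Continuous (fderiv ℝ f) := hf.continuous_fderiv (by simp)
  have h := hasDerivAt_integral_of_compactSpace (𝕜 := ℝ) (volume : Measure E).toSphere
    (F := fun t (u : Metric.sphere (0 : E) 1) => f (t • (u : E)))
    (F' := fun t u => fderiv ℝ f (t • (u : E)) u) (by have := hf.continuous; fun_prop)
    (by fun_prop) (fun t u => by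
      have h1 : HasDerivAt (fun t : ℝ => t • (u : E)) u t := by
        simpa using (hasDerivAt_id t).smul_const (u : E)
      exact (hf.differentiable (by simp) _).hasFDerivAt.comp_hasDerivAt t h1) t
  have ht' : (t : ℂ) ≠ 0 := by exact_mod_cast ht
  have heq : (t : ℂ)⁻¹ * sphereMean (eulerDeriv f) t =
      ⨍ u : Metric.sphere (0 : E) 1, fderiv ℝ f (t • (u : E)) u ∂(volume : Measure E).toSphere := by
    rw [inv_mul_eq_iff_eq_mul₀ ht', sphereMean, average, average, ← integral_const_mul]
    simp [eulerDeriv]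
  rw [heq, average_eq, sphereMean_eq_smul_integral]
  exact h.const_smul ((volume : Measure E).toSphere.real Set.univ)⁻¹

open Set in
/-- Integration in polar coordinates. -/
lemma integral_eq_integral_sphereMean [Nontrivial E] {f : E → ℂ} (hf : Integrable f) :
    ∫ x, f x = (volume : Measure E).toSphere.real univ *
      ∫ r in Ioi (0 : ℝ), (r : ℂ) ^ (Module.finrank ℝ E - 1) * sphereMean f r := by
  have : NeZero (volume : Measure E).toSphere := ⟨Measure.toSphere_ne_zero _⟩
  have hmp := (volume : Measure E).measurePreserving_homeomorphUnitSphereProd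
  have hme := (homeomorphUnitSphereProd E).measurableEmbedding
  set n := Module.finrank ℝ E - 1
  set g : Metric.sphere (0 : E) 1 × Ioi (0 : ℝ) → ℂ := fun q => f ((q.2 : ℝ) • (q.1 : E)) with hg
  have hcomp : ∀ x : ({0}ᶜ : Set E), g (homeomorphUnitSphereProd E x) = f x := by
    intro x
    have : ‖(x : E)‖ ≠ 0 := norm_ne_zero_iff.2 x.2
    simp [hg, smul_smul, this]
  have hgi : Integrable g ((volume : Measure E).toSphere.prod (Measure.volumeIoiPow n)) := by
    rw [← hmp.integrable_comp_emb hme]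
    have : g ∘ homeomorphUnitSphereProd E = f ∘ Subtype.val := funext hcomp
    rw [this]
    exact (integrableOn_iff_comap_subtypeVal (measurableSet_singleton _).compl).1 hf.integrableOn
  calc ∫ x, f x = ∫ x : ({0}ᶜ : Set E), f x ∂(volume : Measure E).comap (↑) := by
        rw [integral_subtype_comap (measurableSet_singleton _).compl f,
          restrict_compl_singleton]
    _ = ∫ q, g q ∂(volume : Measure E).toSphere.prod (Measure.volumeIoiPow n) := by
        rw [← hmp.integral_comp hme]
        simp only [hcomp]
    _ = ∫ r : Ioi (0 : ℝ), (volume : Measure E).toSphere.real univ • sphereMean f r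
          ∂Measure.volumeIoiPow n := by
        rw [integral_prod_symm g hgi]
        simp only [sphereMean, measure_smul_average, hg]
    _ = _ := by
        rw [integral_smul, Complex.real_smul]
        congr 1
        simp only [Measure.volumeIoiPow, ENNReal.ofReal]
        rw [integral_withDensity_eq_integral_smul,
          integral_subtype_comap measurableSet_Ioi
            fun a : ℝ ↦ Real.toNNReal (a ^ n) • sphereMean f a]
        · refine setIntegral_congr_fun measurableSet_Ioi fun x hx ↦ ?_
          simp only [NNReal.smul_def, Real.coe_toNNReal _ (pow_nonneg (le_of_lt hx) n)]
          simp
        · exact (measurable_subtype_coe.pow_const _).real_toNNReal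

/-- Integration of nonnegative functions in polar coordinates. -/
lemma lintegral_eq_lintegral_lintegral_sphere [Nontrivial E] {f : E → ℝ≥0∞} (hf : Measurable f) :
    ∫⁻ x, f x = ∫⁻ r in Set.Ioi (0 : ℝ), ENNReal.ofReal (r ^ (Module.finrank ℝ E - 1)) *
      ∫⁻ u : Metric.sphere (0 : E) 1, f (r • (u : E)) ∂(volume : Measure E).toSphere := by
  have hmp := (volume : Measure E).measurePreserving_homeomorphUnitSphereProd
  have hme := (homeomorphUnitSphereProd E).measurableEmbedding
  set n := Module.finrank ℝ E - 1
  set g : Metric.sphere (0 : E) 1 × Set.Ioi (0 : ℝ) → ℝ≥0∞ :=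
    fun q => f ((q.2 : ℝ) • (q.1 : E)) with hg
  have hgm : Measurable g := hf.comp (by fun_prop)
  have hcomp : ∀ x : ({0}ᶜ : Set E), g (homeomorphUnitSphereProd E x) = f x := by
    intro x
    have : ‖(x : E)‖ ≠ 0 := norm_ne_zero_iff.2 x.2
    simp [hg, smul_smul, this]
  have hinner : Measurable fun r : ℝ =>
      ∫⁻ u : Metric.sphere (0 : E) 1, f (r • (u : E)) ∂(volume : Measure E).toSphere :=
    Measurable.lintegral_prod_right' (f := fun q : ℝ × Metric.sphere (0 : E) 1 =>
      f (q.1 • (q.2 : E))) (hf.comp (by fun_prop))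
  calc ∫⁻ x, f x = ∫⁻ x : ({0}ᶜ : Set E), f x ∂(volume : Measure E).comap (↑) := by
        rw [lintegral_subtype_comap (measurableSet_singleton _).compl f,
          restrict_compl_singleton]
    _ = ∫⁻ q, g q ∂(volume : Measure E).toSphere.prod (Measure.volumeIoiPow n) := by
        rw [← hmp.lintegral_comp hgm]
        simp only [hcomp]
    _ = ∫⁻ r : Set.Ioi (0 : ℝ), ∫⁻ u : Metric.sphere (0 : E) 1, f ((r : ℝ) • (u : E))
          ∂(volume : Measure E).toSphere ∂Measure.volumeIoiPow n :=
        lintegral_prod_symm' g hgm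
    _ = _ := by
        have h := lintegral_withDensity_eq_lintegral_mul
          ((volume : Measure ℝ).comap (Subtype.val : Set.Ioi (0 : ℝ) → ℝ))
          (f := fun r : Set.Ioi (0 : ℝ) => ENNReal.ofReal ((r : ℝ) ^ n)) (by fun_prop)
          (hinner.comp measurable_subtype_coe)
        rw [← lintegral_subtype_comap measurableSet_Ioi]
        exact h

end SphericalMean

/-! ### The Laplacian and spherical means -/

section CompNorm

open scoped ContDiff

lemma hasCompactSupport_comp_norm {E G : Type*} [NormedAddCommGroup E] [ProperSpace E] [Zero G] {φ : ℝ → G}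
    (hφ : HasCompactSupport φ) : HasCompactSupport fun x : E => φ ‖x‖ := by
  obtain ⟨R, hR⟩ := hφ.isCompact.isBounded.subset_closedBall 0
  refine HasCompactSupport.intro (isCompact_closedBall (0 : E) R) fun x hx => ?_
  refine image_eq_zero_of_notMem_tsupport fun h => hx ?_
  simpa using hR h

lemma comp_norm_eventuallyEq_zero {E : Type*} [SeminormedAddCommGroup E] {φ : ℝ → ℝ} (hs : tsupport φ ⊆ Set.Ioi 0) :
    (fun x : E => φ ‖x‖) =ᶠ[𝓝 0] fun _ => 0 := by
  have h0 : φ =ᶠ[𝓝 0] 0 :=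
    notMem_tsupport_iff_eventuallyEq.1 fun h => lt_irrefl (0 : ℝ) (hs h)
  have : Tendsto (fun x : E => ‖x‖) (𝓝 0) (𝓝 0) := by
    simpa using (continuous_norm (E := E)).tendsto 0
  exact this.eventually h0

variable {E : Type*} [NormedAddCommGroup E] [InnerProductSpace ℝ E]

lemma contDiff_comp_norm {φ : ℝ → ℝ} (hφ : ContDiff ℝ ∞ φ) (hs : tsupport φ ⊆ Set.Ioi 0) :
    ContDiff ℝ ∞ fun x : E => φ ‖x‖ := by
  refine contDiff_iff_contDiffAt.2 fun x => ?_
  rcases eq_or_ne x 0 with rfl | hx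
  · exact contDiffAt_const.congr_of_eventuallyEq (comp_norm_eventuallyEq_zero hs)
  · exact hφ.contDiffAt.comp x (contDiffAt_norm ℝ hx)

lemma hasFDerivAt_comp_norm {φ : ℝ → ℝ} (hφ : Differentiable ℝ φ)
    (hs : tsupport φ ⊆ Set.Ioi 0) (x : E) :
    HasFDerivAt (fun x : E => φ ‖x‖) ((deriv φ ‖x‖ / ‖x‖) • innerSL ℝ x) x := by
  rcases eq_or_ne x 0 with rfl | hx
  · have h1 := comp_norm_eventuallyEq_zero (E := E) hs
    simpa using (hasFDerivAt_const (0 : ℝ) (0 : E)).congr_of_eventuallyEq h1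
  · have h1 : HasFDerivAt (fun x : E => ‖x‖) (‖x‖⁻¹ • innerSL ℝ x) x := by
      have h := ((hasStrictFDerivAt_norm_sq x).hasFDerivAt).sqrt
        (pow_ne_zero 2 (norm_ne_zero_iff.2 hx))
      simp only [Real.sqrt_sq (norm_nonneg _)] at h
      convert h using 1
      ext v
      simp
      ring
    have h2 := (hφ ‖x‖).hasDerivAt.comp_hasFDerivAt x h1
    simpa [smul_smul, div_eq_mul_inv, Function.comp_def] using h2

end CompNorm

section Darboux

open scoped ContDiff

variable {E : Type*} [NormedAddCommGroup E] [InnerProductSpace ℝ E] [FiniteDimensional ℝ E]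

lemma laplacian_eq_sum_fderiv_fderiv {f : E → ℂ} (hf : ContDiff ℝ ∞ f) (x : E) :
    (Laplacian.laplacian f : E → ℂ) x = ∑ i, fderiv ℝ (fun y => fderiv ℝ f y
      (stdOrthonormalBasis ℝ E i)) x (stdOrthonormalBasis ℝ E i) := by
  have hd : Differentiable ℝ (fderiv ℝ f) :=
    (hf.fderiv_right (m := ∞) (by simp)).differentiable (by simp)
  rw [InnerProductSpace.laplacian_eq_iteratedFDeriv_stdOrthonormalBasis]
  refine Finset.sum_congr rfl fun i _ => ?_
  rw [iteratedFDeriv_two_apply, fderiv_clm_apply (hd x) (differentiableAt_const _)]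
  simp

lemma ContDiff.laplacian {f : E → ℂ} (hf : ContDiff ℝ ∞ f) :
    ContDiff ℝ ∞ (Laplacian.laplacian f : E → ℂ) := by
  rw [funext (laplacian_eq_sum_fderiv_fderiv hf)]
  refine ContDiff.sum fun i _ => ?_
  have h1 : ContDiff ℝ ∞ (fun y => fderiv ℝ f y (stdOrthonormalBasis ℝ E i)) :=
    (hf.fderiv_right (m := ∞) (by simp)).clm_apply contDiff_const
  exact (h1.fderiv_right (m := ∞) (by simp)).clm_apply contDiff_const

variable [MeasurableSpace E] [BorelSpace E]

/-- Green's identity against a radial test function. -/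
lemma integral_smul_laplacian_eq_neg {f : E → ℂ} (hf : ContDiff ℝ ∞ f) {φ : ℝ → ℝ}
    (hφ : ContDiff ℝ ∞ φ) (hc : HasCompactSupport φ) (hs : tsupport φ ⊆ Set.Ioi 0) :
    ∫ x : E, φ ‖x‖ • (Laplacian.laplacian f : E → ℂ) x =
      -∫ x : E, (deriv φ ‖x‖ / ‖x‖) • eulerDeriv f x := by
  set b := stdOrthonormalBasis ℝ E
  set ψ : E → ℝ := fun x => φ ‖x‖ with hψ
  have hψd : ∀ x, HasFDerivAt ψ ((deriv φ ‖x‖ / ‖x‖) • innerSL ℝ x) x :=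
    hasFDerivAt_comp_norm (hφ.differentiable (by simp)) hs
  have hψs : HasCompactSupport ψ := hasCompactSupport_comp_norm hc
  have hψc : Continuous ψ := hφ.continuous.comp continuous_norm
  have hψ' : Continuous (fderiv ℝ ψ) := by
    refine ContDiff.continuous_fderiv (n := ∞) ?_ (by simp)
    exact contDiff_comp_norm hφ hs
  set g : Fin (Module.finrank ℝ E) → E → ℂ := fun i y => fderiv ℝ f y (b i) with hg
  have hgs : ∀ i, ContDiff ℝ ∞ (g i) := fun i =>
    (hf.fderiv_right (m := ∞) (by simp)).clm_apply contDiff_const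
  have hgd : ∀ i, Continuous fun x => fderiv ℝ (g i) x (b i) := fun i =>
    ((hgs i).continuous_fderiv (by simp)).clm_apply continuous_const
  have i1 : ∀ i, Integrable fun x => ψ x • fderiv ℝ (g i) x (b i) := fun i =>
    (hψc.smul (hgd i)).integrable_of_hasCompactSupport hψs.smul_right
  have i2 : ∀ i, Integrable fun x => fderiv ℝ ψ x (b i) • g i x := fun i =>
    ((hψ'.clm_apply continuous_const).smul (hgs i).continuous).integrable_of_hasCompactSupport
      (hψs.fderiv_apply ℝ (b i)).smul_right
  calc ∫ x : E, φ ‖x‖ • (Laplacian.laplacian f : E → ℂ) x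
      = ∑ i, ∫ x, ψ x • fderiv ℝ (g i) x (b i) := by
        rw [← integral_finsetSum _ fun i _ => i1 i]
        simp only [laplacian_eq_sum_fderiv_fderiv hf, Finset.smul_sum, hψ, hg, b]
    _ = ∑ i, -∫ x, fderiv ℝ ψ x (b i) • g i x := by
        refine Finset.sum_congr rfl fun i _ => ?_
        exact integral_smul_fderiv_eq_neg_fderiv_smul_of_integrable (i2 i) (i1 i)
          ((hψc.smul (hgs i).continuous).integrable_of_hasCompactSupport hψs.smul_right)
          (fun x _ => (hψd x).differentiableAt)
          (fun x _ => (hgs i).differentiable (by simp) x)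
    _ = -∫ x : E, (deriv φ ‖x‖ / ‖x‖) • eulerDeriv f x := by
        rw [Finset.sum_neg_distrib, ← integral_finsetSum _ fun i _ => i2 i]
        congr 2
        funext x
        have hx : fderiv ℝ f x x = ∑ i, inner ℝ (b i) x • fderiv ℝ f x (b i) := by
          conv_lhs => rw [← b.sum_repr' x, map_sum]
          simp only [map_smul, b.sum_repr' x]
        simp only [(hψd x).fderiv, eulerDeriv, hx, Finset.smul_sum, smul_smul, hg,
          smul_apply, innerSL_apply_apply, smul_eq_mul]
        simp only [real_inner_comm]

end Darboux

section DarbouxEquation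

open scoped ContDiff

variable {E : Type*} [NormedAddCommGroup E] [InnerProductSpace ℝ E] [FiniteDimensional ℝ E]
  [MeasurableSpace E] [BorelSpace E]

lemma integral_comp_norm_smul [Nontrivial E] {χ : ℝ → ℝ} (hχ : Continuous χ)
    (hc : HasCompactSupport χ) {f : E → ℂ} (hf : Continuous f) :
    ∫ x : E, χ ‖x‖ • f x = (volume : Measure E).toSphere.real Set.univ * ∫ r in Set.Ioi (0 : ℝ),
      (r : ℂ) ^ (Module.finrank ℝ E - 1) * (χ r • sphereMean f r) := by
  have hi : Integrable fun x : E => χ ‖x‖ • f x := ((hχ.comp continuous_norm).smul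
    hf).integrable_of_hasCompactSupport (hasCompactSupport_comp_norm hc).smul_right
  rw [integral_eq_integral_sphereMean hi]
  congr 1
  refine setIntegral_congr_fun measurableSet_Ioi fun r hr => ?_
  have hr' : |r| = r := abs_of_pos hr
  simp only [sphereMean, average, norm_smul, Real.norm_eq_abs, hr', norm_eq_of_mem_sphere, mul_one,
    integral_smul]

/-- **Darboux's equation** `t² M(Δf) = M(R²f) + (n - 2) M(Rf)` for the spherical means `M` of a
smooth function on an `n`-dimensional space, where `R` is the derivative along the Euler field.
Since `R` acts on spherical means as `t d/dt`, this says that `M(Δf)` is the Bessel operator of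
order `n/2 - 1` applied to `M f`. Both sides have the same integral against every test function on
the half-line, by Green's identity on the space and integration by parts in the radius. -/
lemma sq_mul_sphereMean_laplacian [Nontrivial E] {f : E → ℂ} (hf : ContDiff ℝ ∞ f) {t : ℝ}
    (ht : 0 < t) :
    (t : ℂ) ^ 2 * sphereMean (Laplacian.laplacian f : E → ℂ) t =
      sphereMean (eulerDeriv (eulerDeriv f)) t +
        ((Module.finrank ℝ E : ℂ) - 2) * sphereMean (eulerDeriv f) t := by
  have harea : ((volume : Measure E).toSphere.real Set.univ : ℂ) ≠ 0 := by
    have : NeZero (volume : Measure E).toSphere := ⟨Measure.toSphere_ne_zero _⟩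
    exact_mod_cast measureReal_univ_ne_zero (μ := (volume : Measure E).toSphere)
  obtain ⟨j, hj⟩ : ∃ j, Module.finrank ℝ E = j + 1 :=
    Nat.exists_eq_succ_of_ne_zero Module.finrank_pos.ne'
  set A := sphereMean (Laplacian.laplacian f : E → ℂ) with hA
  set B := sphereMean (eulerDeriv (eulerDeriv f)) with hB
  set C := sphereMean (eulerDeriv f) with hC
  have hAc : Continuous A := continuous_sphereMean hf.laplacian.continuous
  have hBc : Continuous B := continuous_sphereMean hf.eulerDeriv.eulerDeriv.continuous
  have hCc : Continuous C := continuous_sphereMean hf.eulerDeriv.continuous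
  have hinv : ContinuousOn (fun r : ℝ => (r : ℂ)⁻¹) (Set.Ioi 0) :=
    ContinuousOn.inv₀ (by fun_prop) fun r hr => by exact_mod_cast (ne_of_gt hr)
  -- `r ^ (n - 2) * C r` and its derivative.
  set q : ℝ → ℂ := fun r => (r : ℂ) ^ j * ((r : ℂ)⁻¹ * C r) with hq
  set q' : ℝ → ℂ := fun r =>
    (r : ℂ) ^ j * ((r : ℂ)⁻¹ * ((r : ℂ)⁻¹ * (B r + ((j : ℂ) - 1) * C r))) with hq'
  have hqc : ContinuousOn q (Set.Ioi 0) :=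
    ContinuousOn.mul (by fun_prop) (hinv.mul hCc.continuousOn)
  have hq'c : ContinuousOn q' (Set.Ioi 0) :=
    ContinuousOn.mul (by fun_prop) (hinv.mul (hinv.mul (by fun_prop)))
  have hqd : ∀ r : ℝ, 0 < r → HasDerivAt q (q' r) r := by
    intro r hr
    have hr0 : (r : ℂ) ≠ 0 := by exact_mod_cast hr.ne'
    have h1 : HasDerivAt (fun r : ℝ => (r : ℂ)) 1 r := Complex.ofRealCLM.hasDerivAt
    have h2 := (h1.pow j).mul ((h1.inv hr0).mul (hasDerivAt_sphereMean hf.eulerDeriv hr.ne'))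
    refine h2.congr_deriv ?_
    have h3 : (r : ℂ) ^ j * (j * (r : ℂ)⁻¹) = j * (r : ℂ) ^ (j - 1) := by
      rcases j with _ | j
      · simp
      · field_simp
        simp [pow_succ, mul_comm]
    simp only [Pi.mul_apply, Pi.pow_apply, Pi.inv_apply, ← hB, ← hC, hq', mul_one]
    rw [← h3]
    field_simp
    ring
  have hzero : ∀ᵐ r : ℝ, r ∈ Set.Ioi (0 : ℝ) → (r : ℂ) ^ j * A r - q' r = 0 := by
    have hkc : ContinuousOn (fun r : ℝ => (r : ℂ) ^ j * A r - q' r) (Set.Ioi 0) :=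
      ContinuousOn.sub (by fun_prop) hq'c
    refine isOpen_Ioi.ae_eq_zero_of_integral_contDiff_smul_eq_zero
      (hkc.locallyIntegrableOn measurableSet_Ioi) fun φ hφ hc hs => ?_
    have hcont : ∀ {χ : ℝ → ℝ} {g : ℝ → ℂ}, Continuous χ → tsupport χ ⊆ Set.Ioi 0 →
        ContinuousOn g (Set.Ioi 0) → Continuous fun r => χ r • g r := fun hχ hχs hg =>
      (hχ.continuousOn.smul hg).continuous_of_tsupport_subset isOpen_Ioi
        ((tsupport_smul_subset_left _ _).trans hχs)
    have hφ' : Continuous (deriv φ) := hφ.continuous_deriv (by simp)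
    have hs' : tsupport (deriv φ) ⊆ Set.Ioi 0 := (tsupport_deriv_subset (𝕜 := ℝ)).trans hs
    have hc' : HasCompactSupport (deriv φ) := hc.deriv
    have hint : ∀ {χ : ℝ → ℝ} {g : ℝ → ℂ}, Continuous χ → tsupport χ ⊆ Set.Ioi 0 →
        HasCompactSupport χ → ContinuousOn g (Set.Ioi 0) → Integrable fun r => χ r • g r :=
      fun hχ hχs hχc hg => (hcont hχ hχs hg).integrable_of_hasCompactSupport hχc.smul_right
    have hset : ∀ {χ : ℝ → ℝ} {g : ℝ → ℂ}, tsupport χ ⊆ Set.Ioi 0 →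
        ∫ r in Set.Ioi (0 : ℝ), χ r • g r = ∫ r, χ r • g r := fun {χ g} hχs =>
      setIntegral_eq_integral_of_forall_compl_eq_zero fun r hr => by
        rw [image_eq_zero_of_notMem_tsupport fun h => hr (hχs h), zero_smul]
    -- Integration by parts in the radius.
    have hparts : ∫ r, (deriv φ r • q r + φ r • q' r) = 0 := by
      refine integral_eq_zero_of_hasDerivAt_of_integrable (f := fun r => φ r • q r) (fun r => ?_)
        ((hint hφ' hs' hc' hqc).add (hint hφ.continuous hs hc hq'c))
        (hint hφ.continuous hs hc hqc)
      by_cases hr : r ∈ tsupport φ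
      · have := ((hφ.differentiable (by simp) r).hasDerivAt).smul (hqd r (hs hr))
        rwa [add_comm]
      · have h0 : φ =ᶠ[𝓝 r] 0 := notMem_tsupport_iff_eventuallyEq.1 hr
        have h1 : (fun r => φ r • q r) =ᶠ[𝓝 r] fun _ => 0 := h0.mono fun s hs => by simp [hs]
        rw [image_eq_zero_of_notMem_tsupport hr,
          image_eq_zero_of_notMem_tsupport fun h => hr (tsupport_deriv_subset (𝕜 := ℝ) h)]
        simpa using (hasDerivAt_const r (0 : ℂ)).congr_of_eventuallyEq h1
    rw [integral_add (hint hφ' hs' hc' hqc) (hint hφ.continuous hs hc hq'c)] at hparts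
    -- Green's identity in polar coordinates.
    have hgreen := integral_smul_laplacian_eq_neg hf hφ hc hs
    have hdiv : Continuous fun r => deriv φ r / r :=
      (hφ'.continuousOn.div continuousOn_id fun r hr => ne_of_gt hr).continuous_of_tsupport_subset
        isOpen_Ioi ((closure_mono fun r hr => by
          simp only [Function.mem_support] at hr ⊢
          exact fun h => hr (by simp [h])).trans hs')
    have hdivc : HasCompactSupport fun r => deriv φ r / r :=
      hc'.mono fun r hr => by
        simp only [Function.mem_support] at hr ⊢
        exact fun h => hr (by simp [h])
    rw [integral_comp_norm_smul hφ.continuous hc hf.laplacian.continuous,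
      integral_comp_norm_smul hdiv hdivc hf.eulerDeriv.continuous, hj, Nat.add_sub_cancel,
      ← hA, ← hC] at hgreen
    have e1 : ∫ r in Set.Ioi (0 : ℝ), (r : ℂ) ^ j * (φ r • A r) =
        ∫ r, φ r • ((r : ℂ) ^ j * A r) := by
      rw [← hset hs]
      simp only [mul_smul_comm]
    have e2 : ∫ r in Set.Ioi (0 : ℝ), (r : ℂ) ^ j * ((deriv φ r / r) • C r) =
        ∫ r, deriv φ r • q r := by
      rw [← hset hs']
      refine setIntegral_congr_fun measurableSet_Ioi fun r _ => ?_
      simp only [hq, Complex.real_smul]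
      push_cast
      ring
    rw [e1, e2, ← mul_neg] at hgreen
    have hgreen := mul_left_cancel₀ harea hgreen
    simp only [smul_sub]
    rw [integral_sub (hint hφ.continuous hs hc (by fun_prop))
      (hint hφ.continuous hs hc hq'c), hgreen]
    linear_combination -hparts
  have heq : Set.EqOn (fun r : ℝ => (r : ℂ) ^ j * A r) q' (Set.Ioi 0) := by
    refine Measure.eqOn_open_of_ae_eq (μ := volume) ?_ isOpen_Ioi (by fun_prop) hq'c
    filter_upwards [(ae_restrict_iff' measurableSet_Ioi).2 hzero] with r hr
    exact sub_eq_zero.1 hr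
  have h := heq (show t ∈ Set.Ioi 0 from ht)
  have ht0 : (t : ℂ) ≠ 0 := by exact_mod_cast ht.ne'
  have h2 := mul_left_cancel₀ (pow_ne_zero j ht0) h
  rw [h2, hj]
  push_cast
  field_simp
  ring

/-- The Bessel operator of order `n/2 - 1` turns the spherical means of `f` into those of `Δf`. At
the origin the limit in the definition of the Bessel operator exists because the means of `Δf` are
continuous there. -/
lemma besselOp_sphereMean [Nontrivial E] {f : E → ℂ} (hf : ContDiff ℝ ∞ f) :
    besselOp ((Module.finrank ℝ E : ℝ) / 2 - 1) (sphereMean f) =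
      sphereMean (Laplacian.laplacian f : E → ℂ) := by
  set A := sphereMean (Laplacian.laplacian f : E → ℂ) with hA
  have hAc : Continuous A := continuous_sphereMean hf.laplacian.continuous
  have hD : ∀ t : ℝ, t ≠ 0 → (t : ℂ) ^ 2 * A t = sphereMean (eulerDeriv (eulerDeriv f)) t +
        ((Module.finrank ℝ E : ℂ) - 2) * sphereMean (eulerDeriv f) t := by
    intro t ht
    rcases lt_or_gt_of_ne ht with h | h
    · have := sq_mul_sphereMean_laplacian hf (neg_pos.2 h)
      simpa only [sphereMean_neg, Complex.ofReal_neg, neg_sq] using this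
    · exact sq_mul_sphereMean_laplacian hf h
  have hb : ∀ t : ℝ, t ≠ 0 → deriv (deriv (sphereMean f)) t +
      ((2 * ((Module.finrank ℝ E : ℝ) / 2 - 1) + 1) / t) • deriv (sphereMean f) t = A t := by
    intro t ht
    have ht' : (t : ℂ) ≠ 0 := by exact_mod_cast ht
    have h1 : deriv (sphereMean f) =ᶠ[𝓝 t]
        fun s : ℝ => (s : ℂ)⁻¹ * sphereMean (eulerDeriv f) s :=
      (eventually_ne_nhds ht).mono fun s hs => (hasDerivAt_sphereMean hf hs).deriv
    have h2 : HasDerivAt (fun r : ℝ => (r : ℂ)) 1 t := Complex.ofRealCLM.hasDerivAt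
    have h3 := (h2.inv ht').mul (hasDerivAt_sphereMean hf.eulerDeriv ht)
    have h4 := (h3.congr_of_eventuallyEq h1).deriv
    rw [h4, h1.self_of_nhds]
    refine mul_left_cancel₀ (pow_ne_zero 2 ht') ?_
    rw [hD t ht, Complex.real_smul]
    simp only [Pi.inv_apply]
    push_cast
    field_simp
    ring
  funext t
  simp only [besselOp]
  split_ifs with h
  · subst h
    refine Tendsto.limUnder_eq ?_
    refine ((hAc.tendsto 0).mono_left nhdsWithin_le_nhds).congr' ?_
    filter_upwards [self_mem_nhdsWithin] with t ht
    exact (hb t ht).symm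
  · exact hb t h

/-- The iterated Bessel operator of a spherical mean at the origin is the iterated Laplacian. -/
lemma iterate_besselOp_sphereMean_zero [Nontrivial E] (N : ℕ) {f : E → ℂ}
    (hf : ContDiff ℝ ∞ f) :
    (besselOp ((Module.finrank ℝ E : ℝ) / 2 - 1))^[N] (sphereMean f) 0 =
      ((Laplacian.laplacian^[N] f : E → ℂ)) 0 := by
  induction N generalizing f with
  | zero => exact sphereMean_zero f
  | succ N ih =>
    rw [Function.iterate_succ_apply, Function.iterate_succ_apply, besselOp_sphereMean hf]
    exact ih hf.laplacian

end DarbouxEquation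

/-! ### Comparison of the norms -/

section Norms

lemma lintegral_eq_two_mul_of_even {h : ℝ → ℝ≥0∞} (heven : ∀ t, h (-t) = h t) :
    ∫⁻ t, h t = 2 * ∫⁻ t in Set.Ioi 0, h t := by
  have hneg : ∫⁻ t in Set.Iic 0, h t = ∫⁻ t in Set.Ioi 0, h t := by
    have h1 := (Measure.measurePreserving_neg (volume : Measure ℝ)).setLIntegral_comp_preimage_emb
      (Homeomorph.neg ℝ).measurableEmbedding h (Set.Ici 0)
    simp only [heven, Set.neg_preimage, Set.neg_Ici, neg_zero] at h1
    rw [h1, setLIntegral_congr Ioi_ae_eq_Ici]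
  rw [← lintegral_add_compl h (measurableSet_Ioi (a := (0 : ℝ))), Set.compl_Ioi, hneg, two_mul]

lemma lintegral_powerWeight (k : ℕ) {h : ℝ → ℝ≥0∞} (hm : Measurable h)
    (heven : ∀ t, h (-t) = h t) :
    ∫⁻ t, h t ∂powerWeight k = 2 * ∫⁻ r in Set.Ioi (0 : ℝ), ENNReal.ofReal (r ^ k) * h r := by
  rw [powerWeight, lintegral_withDensity_eq_lintegral_mul _ (by fun_prop) hm,
    lintegral_eq_two_mul_of_even (by simp [heven])]
  congr 1
  refine setLIntegral_congr_fun measurableSet_Ioi fun r hr => ?_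
  simp only [Pi.mul_apply, abs_of_pos (show (0 : ℝ) < r from hr)]

variable {E : Type*} [NormedAddCommGroup E] [InnerProductSpace ℝ E] [FiniteDimensional ℝ E]
  [MeasurableSpace E] [BorelSpace E]

/-- The images of the Lebesgue measure under the norm and of the weighted measure on the line under
the absolute value are proportional. -/
lemma map_norm_volume [Nontrivial E] :
    (volume : Measure E).map (fun x => ‖x‖) =
      ((volume : Measure E).toSphere Set.univ / 2) •
        (powerWeight (Module.finrank ℝ E - 1)).map (fun t => |t|) := by
  refine Measure.ext fun s hs => ?_
  have hs1 : Measurable (s.indicator (1 : ℝ → ℝ≥0∞)) := measurable_one.indicator hs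
  rw [Measure.smul_apply, smul_eq_mul, ← lintegral_indicator_one hs, ← lintegral_indicator_one hs,
    lintegral_map hs1 measurable_norm, lintegral_map hs1 (by fun_prop),
    lintegral_eq_lintegral_lintegral_sphere
      (f := fun x : E => s.indicator 1 ‖x‖) (hs1.comp measurable_norm),
    lintegral_powerWeight _ (h := fun t => s.indicator 1 |t|) (hs1.comp (by fun_prop)) (by simp), ← mul_assoc,
    ENNReal.div_mul_cancel two_ne_zero ENNReal.ofNat_ne_top,
    ← lintegral_const_mul _ (by have := hs1.comp (measurable_norm (α := ℝ)); fun_prop)]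
  refine setLIntegral_congr_fun measurableSet_Ioi fun r hr => ?_
  simp only [norm_smul, norm_eq_of_mem_sphere, mul_one, lintegral_const, Real.norm_eq_abs]
  ring

/-- The norm of a radial function on an `n`-dimensional space, in terms of its even profile on the
line with weight `|t|^(n-1)`. The case `p = ∞` is covered, with exponent `0`. -/
lemma eLpNorm_comp_norm [Nontrivial E] (p : ℝ≥0∞) {g : ℝ → ℂ} (hg : Continuous g)
    (heven : ∀ t, g (-t) = g t) :
    eLpNorm (fun x : E => g ‖x‖) p volume =
      ((volume : Measure E).toSphere Set.univ / 2) ^ (p⁻¹).toReal *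
        eLpNorm g p (powerWeight (Module.finrank ℝ E - 1)) := by
  have hne : (volume : Measure E).toSphere Set.univ / 2 ≠ 0 :=
    (ENNReal.div_pos (Measure.measure_univ_ne_zero.2 (Measure.toSphere_ne_zero _))
      ENNReal.ofNat_ne_top).ne'
  have h1 : eLpNorm (fun x : E => g ‖x‖) p volume =
      eLpNorm g p ((volume : Measure E).map (fun x => ‖x‖)) :=
    (eLpNorm_map_measure hg.aestronglyMeasurable (by fun_prop)).symm
  have h2 : eLpNorm g p ((powerWeight (Module.finrank ℝ E - 1)).map (fun t => |t|)) =
      eLpNorm g p (powerWeight (Module.finrank ℝ E - 1)) := by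
    rw [eLpNorm_map_measure hg.aestronglyMeasurable (by fun_prop)]
    congr 1
    funext t
    rcases abs_choice t with h | h <;> simp [h, heven]
  rw [h1, map_norm_volume, eLpNorm_smul_measure_of_ne_zero hne, h2, smul_eq_mul, one_div]

/-- For continuous functions the essential supremum bounds every value. -/
lemma enorm_le_eLpNorm_top {f : E → ℂ} (hf : Continuous f) (x : E) :
    ‖f x‖ₑ ≤ eLpNorm f ∞ volume := by
  have hd := Measure.dense_of_ae (μ := (volume : Measure E))
    (by simpa only [eLpNorm_exponent_top] using ae_le_eLpNormEssSup (f := f) (μ := volume))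
  have hc : IsClosed {x | ‖f x‖ₑ ≤ eLpNormEssSup f (volume : Measure E)} :=
    isClosed_le hf.enorm continuous_const
  have : x ∈ {x | ‖f x‖ₑ ≤ eLpNormEssSup f (volume : Measure E)} := by
    rw [← hc.closure_eq, hd.closure_eq]
    trivial
  simpa using this

/-- Spherical means do not increase the norm, up to the normalisation of the measures: by Jensen's
inequality on the sphere and polar coordinates for `p < ∞`, pointwise for `p = ∞`. -/
lemma eLpNorm_sphereMean_le [Nontrivial E] {p : ℝ≥0∞} (hp : 1 ≤ p) {f : E → ℂ}
    (hf : Continuous f) :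
    eLpNorm (sphereMean f) p (powerWeight (Module.finrank ℝ E - 1)) ≤
      (2 / (volume : Measure E).toSphere Set.univ) ^ (p⁻¹).toReal * eLpNorm f p volume := by
  set c := (volume : Measure E).toSphere Set.univ with hc
  have : NeZero (volume : Measure E).toSphere := ⟨Measure.toSphere_ne_zero _⟩
  have hc0 : c ≠ 0 := Measure.measure_univ_ne_zero.2 (Measure.toSphere_ne_zero _)
  have hct : c ≠ ∞ := measure_ne_top _ _
  set σ := c⁻¹ • (volume : Measure E).toSphere with hσ
  have hmean : ∀ t, ‖sphereMean f t‖ₑ ≤ eLpNorm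
      (fun u : Metric.sphere (0 : E) 1 => f (t • (u : E))) p σ := fun t =>
    calc ‖sphereMean f t‖ₑ ≤ eLpNorm (fun u : Metric.sphere (0 : E) 1 => f (t • (u : E))) 1 σ := by
          rw [eLpNorm_one_eq_lintegral_enorm]
          exact enorm_integral_le_lintegral_enorm _
      _ ≤ _ := eLpNorm_le_eLpNorm_of_exponent_le hp
          (Continuous.aestronglyMeasurable (by fun_prop))
  rcases eq_or_ne p ∞ with rfl | hpt
  · simp only [ENNReal.inv_top, ENNReal.toReal_zero, ENNReal.rpow_zero, one_mul]
    rw [eLpNorm_exponent_top]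
    refine eLpNormEssSup_le_of_ae_enorm_bound (Eventually.of_forall fun t => (hmean t).trans ?_)
    rw [eLpNorm_exponent_top (f := fun u : Metric.sphere (0 : E) 1 => f (t • (u : E)))]
    exact eLpNormEssSup_le_of_ae_enorm_bound
      (Eventually.of_forall fun u => enorm_le_eLpNorm_top hf _)
  · have hp0 : p ≠ 0 := (zero_lt_one.trans_le hp).ne'
    have hq : 0 < p.toReal := ENNReal.toReal_pos hp0 hpt
    have hpow : ∀ t, ‖sphereMean f t‖ₑ ^ p.toReal ≤ c⁻¹ *
        ∫⁻ u : Metric.sphere (0 : E) 1, ‖f (t • (u : E))‖ₑ ^ p.toReal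
          ∂(volume : Measure E).toSphere := fun t => by
      have h := ENNReal.rpow_le_rpow (hmean t) hq.le
      rwa [eLpNorm_eq_lintegral_rpow_enorm_toReal hp0 hpt, one_div,
        ENNReal.rpow_inv_rpow hq.ne', hσ, lintegral_smul_measure, smul_eq_mul] at h
    have hfm : Measurable fun x : E => ‖f x‖ₑ ^ p.toReal := by
      have := hf.measurable
      fun_prop
    have hgm : Measurable fun t : ℝ => ‖sphereMean f t‖ₑ ^ p.toReal := by
      have := (continuous_sphereMean hf).measurable
      fun_prop
    have hmain : ∫⁻ t, ‖sphereMean f t‖ₑ ^ p.toReal ∂powerWeight (Module.finrank ℝ E - 1) ≤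
        2 / c * ∫⁻ x, ‖f x‖ₑ ^ p.toReal := by
      rw [lintegral_powerWeight _ hgm (by simp [sphereMean_neg]), div_eq_mul_inv, mul_assoc,
        lintegral_eq_lintegral_lintegral_sphere hfm,
        ← lintegral_const_mul' _ _ (ENNReal.inv_ne_top.2 hc0)]
      gcongr 2 * ?_
      refine lintegral_mono fun r => ?_
      rw [mul_left_comm]
      gcongr
      exact hpow r
    rw [eLpNorm_eq_lintegral_rpow_enorm_toReal hp0 hpt,
      eLpNorm_eq_lintegral_rpow_enorm_toReal hp0 hpt, ENNReal.toReal_inv, one_div,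
      ← ENNReal.mul_rpow_of_nonneg _ _ (inv_nonneg.2 hq.le)]
    exact ENNReal.rpow_le_rpow hmain (inv_nonneg.2 hq.le)

end Norms

/-! ### Passing between one and several complex variables -/

section Correspondence

/-- An even entire function is an entire function of the square of the variable. -/
lemma exists_entire_comp_sq {G : ℂ → ℂ} (hG : Differentiable ℂ G) (heven : ∀ z, G (-z) = G z) :
    ∃ H : ℂ → ℂ, Differentiable ℂ H ∧ ∀ z, H (z ^ 2) = G z := by
  choose s hs using fun w : ℂ => IsAlgClosed.exists_pow_nat_eq w two_pos
  have hval : ∀ {z w : ℂ}, z ^ 2 = w → G (s w) = G z := fun {z w} h => by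
    rcases sq_eq_sq_iff_eq_or_eq_neg.1 ((hs w).trans h.symm) with h | h <;> simp [h, heven]
  have hne : ∀ w : ℂ, w ≠ 0 → DifferentiableAt ℂ (fun w => G (s w)) w := by
    intro w₀ hw₀
    -- A holomorphic branch of the square root near `w₀`.
    have hb : DifferentiableAt ℂ (fun w => s w₀ * (w / w₀) ^ (1 / 2 : ℂ)) w₀ :=
      (DifferentiableAt.cpow (by fun_prop) (by fun_prop)
        (by simp [div_self hw₀])).const_mul _
    refine ((hG _).comp w₀ hb).congr_of_eventuallyEq (Eventually.of_forall fun w => ?_)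
    refine hval ?_
    rw [mul_pow, hs, ← Complex.cpow_nat_mul]
    simp [mul_div_cancel₀ _ hw₀]
  have hcont : ContinuousAt (fun w => G (s w)) 0 := by
    have hs0 : s 0 = 0 := pow_eq_zero_iff two_ne_zero |>.1 (hs 0)
    have hsc : ContinuousAt s 0 := by
      rw [Metric.continuousAt_iff]
      intro ε hε
      refine ⟨ε ^ 2, by positivity, fun {w} hw => ?_⟩
      rw [dist_zero_right, ← hs w, norm_pow] at hw
      rw [hs0, dist_zero_right]
      exact lt_of_pow_lt_pow_left₀ 2 hε.le hw
    exact hG.continuous.continuousAt.comp hsc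
  refine ⟨fun w => G (s w), fun w => ?_, fun z => hval rfl⟩
  rcases eq_or_ne w 0 with rfl | hw
  -- Across the branch point the singularity is removable.
  · have h := (Complex.differentiableOn_compl_singleton_and_continuousAt_iff
      (s := Set.univ) (f := fun w => G (s w)) (c := 0) univ_mem).1
      ⟨fun w hw => (hne w (by simpa using hw)).differentiableWithinAt, hcont⟩
    exact (h 0 trivial).differentiableAt univ_mem
  · exact hne w hw

variable {m : ℕ}

lemma norm_complexify (x : EuclideanSpace ℝ (Fin m)) : ‖complexify x‖ = ‖x‖ := by
  simp [EuclideanSpace.norm_eq, complexify]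

lemma complexify_smul (t : ℝ) (x : EuclideanSpace ℝ (Fin m)) :
    complexify (t • x) = (t : ℂ) • complexify x := by
  ext i
  simp [complexify]

lemma complexify_neg (x : EuclideanSpace ℝ (Fin m)) : complexify (-x) = -complexify x := by
  ext i
  simp [complexify]

/-- `complexify` as a continuous linear map. -/
noncomputable def complexifyCLM (m : ℕ) :
    EuclideanSpace ℝ (Fin m) →L[ℝ] EuclideanSpace ℂ (Fin m) :=
  LinearMap.toContinuousLinearMap
    { toFun := complexify
      map_add' := fun x y => by ext i; simp [complexify]
      map_smul' := fun t x => by ext i; simp [complexify] }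

lemma continuous_complexify : Continuous (complexify (m := m)) := (complexifyCLM m).continuous

open scoped ContDiff in
lemma contDiff_of_mem_sphericalTypeClass {σ : ℝ} {f : EuclideanSpace ℝ (Fin m) → ℂ}
    (hf : f ∈ sphericalTypeClass σ m) : ContDiff ℝ ∞ f := by
  obtain ⟨F, ⟨hF, -⟩, hfF⟩ := hf
  rw [funext hfF]
  exact ((contDiff_infty_of_entire hF).restrict_scalars ℝ).comp (complexifyCLM m).contDiff

lemma continuous_of_mem_evenTypeClass {σ : ℝ} {g : ℝ → ℂ} (hg : g ∈ evenTypeClass σ) :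
    Continuous g := by
  obtain ⟨G, ⟨hG, -⟩, -, hgG⟩ := hg
  rw [funext hgG]
  exact hG.continuous.comp Complex.continuous_ofReal

lemma even_of_mem_evenTypeClass {σ : ℝ} {g : ℝ → ℂ} (hg : g ∈ evenTypeClass σ) (t : ℝ) :
    g (-t) = g t := by
  obtain ⟨G, -, hG, hgG⟩ := hg
  simp [hgG, hG]

/-- The radial extension of an even function of exponential type is of the same spherical type:
its complexification is `G(√(∑ z_i²))`, and `|∑ z_i²| ≤ |z|²`. -/
lemma comp_norm_mem_sphericalTypeClass {σ : ℝ} (hσ : 0 ≤ σ) {g : ℝ → ℂ}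
    (hg : g ∈ evenTypeClass σ) :
    (fun x : EuclideanSpace ℝ (Fin m) => g ‖x‖) ∈ sphericalTypeClass σ m := by
  obtain ⟨G, ⟨hG, hbound⟩, heven, hgG⟩ := hg
  obtain ⟨H, hH, hHG⟩ := exists_entire_comp_sq hG heven
  refine ⟨fun z => H (∑ i, z i ^ 2), ⟨hH.comp (by fun_prop), fun ε hε => ?_⟩, fun x => ?_⟩
  · obtain ⟨C, hC⟩ := hbound ε hε
    have hC0 : 0 ≤ C := by simpa using (norm_nonneg _).trans (hC 0)
    refine ⟨C, fun z => ?_⟩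
    obtain ⟨ζ, hζ⟩ := IsAlgClosed.exists_pow_nat_eq (∑ i, z i ^ 2) two_pos
    have hle : ‖ζ‖ ≤ ‖z‖ := by
      refine le_of_sq_le_sq ?_ (norm_nonneg _)
      rw [← norm_pow, hζ, EuclideanSpace.norm_sq_eq]
      exact (norm_sum_le _ _).trans (by simp)
    simp only
    rw [← hζ, hHG]
    refine (hC ζ).trans ?_
    gcongr
  · simp only [hgG]
    rw [← hHG, ← Complex.ofReal_pow, EuclideanSpace.norm_sq_eq]
    simp [complexify]

/-- The spherical means of a function of spherical type extend to the even entire function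
`z ↦ ⨍ F(z u) du` of the same type. -/
lemma sphereMean_mem_evenTypeClass [NeZero m] {σ : ℝ} {f : EuclideanSpace ℝ (Fin m) → ℂ}
    (hf : f ∈ sphericalTypeClass σ m) : sphereMean f ∈ evenTypeClass σ := by
  obtain ⟨F, ⟨hF, hbound⟩, hfF⟩ := hf
  set μ := (volume : Measure (EuclideanSpace ℝ (Fin m))).toSphere with hμ
  have : NeZero μ := ⟨Measure.toSphere_ne_zero _⟩
  have hc : Continuous (complexify (m := m)) := continuous_complexify
  have hF' : Continuous (fderiv ℂ F) := (contDiff_infty_of_entire hF).continuous_fderiv (by simp)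
  set G : ℂ → ℂ := fun z => ∫ u : Metric.sphere (0 : EuclideanSpace ℝ (Fin m)) 1,
    F (z • complexify (u : EuclideanSpace ℝ (Fin m))) ∂μ with hG
  refine ⟨fun z => (μ.real Set.univ)⁻¹ • G z, ⟨?_, fun ε hε => ?_⟩, fun z => ?_, fun t => ?_⟩
  · suffices hGd : Differentiable ℂ G from hGd.const_smul (μ.real Set.univ)⁻¹
    intro z
    refine (hasDerivAt_integral_of_compactSpace (𝕜 := ℂ) μ
      (F := fun z u => F (z • complexify (u : EuclideanSpace ℝ (Fin m))))
      (F' := fun z u => fderiv ℂ F (z • complexify (u : EuclideanSpace ℝ (Fin m)))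
        (complexify (u : EuclideanSpace ℝ (Fin m))))
      (by have := hF.continuous; fun_prop) (by fun_prop) (fun z u => ?_) z).differentiableAt
    have h1 : HasDerivAt (fun z : ℂ => z • complexify (u : EuclideanSpace ℝ (Fin m)))
        (complexify (u : EuclideanSpace ℝ (Fin m))) z := by
      simpa using (hasDerivAt_id z).smul_const (complexify (u : EuclideanSpace ℝ (Fin m)))
    exact (hF _).hasFDerivAt.comp_hasDerivAt z h1
  · obtain ⟨C, hC⟩ := hbound ε hε
    refine ⟨C, fun z => ?_⟩
    have hpos : 0 < μ.real Set.univ :=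
      lt_of_le_of_ne measureReal_nonneg (measureReal_univ_ne_zero (μ := μ)).symm
    have h := norm_integral_le_of_norm_le_const (μ := μ) (C := C * Real.exp (σ * (1 + ε) * ‖z‖))
      (f := fun u : Metric.sphere (0 : EuclideanSpace ℝ (Fin m)) 1 =>
        F (z • complexify (u : EuclideanSpace ℝ (Fin m)))) (Eventually.of_forall fun u => by
          simpa [norm_smul, norm_complexify] using
            hC (z • complexify (u : EuclideanSpace ℝ (Fin m))))
    rw [norm_smul, norm_inv, Real.norm_of_nonneg hpos.le, inv_mul_le_iff₀ hpos, mul_comm]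
    exact h
  · have h := (measurePreserving_neg_toSphere (E := EuclideanSpace ℝ (Fin m))).integral_comp
      (Homeomorph.neg (Metric.sphere (0 : EuclideanSpace ℝ (Fin m)) 1)).measurableEmbedding
      (fun u => F (z • complexify (u : EuclideanSpace ℝ (Fin m))))
    simp only [hG, ← h, hμ]
    simp [complexify_neg]
  · rw [sphereMean_eq_smul_integral]
    simp [hfF, complexify_smul, hG, hμ]

end Correspondence

/-! ### Equality of the sharp constants -/

lemma sphereMean_comp_norm {E : Type*} [NormedAddCommGroup E] [InnerProductSpace ℝ E]
    [FiniteDimensional ℝ E] [MeasurableSpace E] [BorelSpace E] [Nontrivial E] {g : ℝ → ℂ}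
    (heven : ∀ t, g (-t) = g t) : sphereMean (fun x : E => g ‖x‖) = g := by
  have : NeZero (volume : Measure E).toSphere := ⟨Measure.toSphere_ne_zero _⟩
  funext t
  have ht : g |t| = g t := by rcases abs_choice t with h | h <;> simp [h, heven]
  simp only [sphereMean, norm_smul, norm_eq_of_mem_sphere, mul_one, Real.norm_eq_abs, ht]
  exact average_const _ _

theorem corollary2p13 (m : ℕ) (hm : 1 ≤ m) (N : ℕ) (p : ℝ≥0∞) (hp : 1 ≤ p) :
    sharpConstant
        (sphericalTypeClass 1 m ∩ lpClass p (volume : Measure (EuclideanSpace ℝ (Fin m))))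
        p (volume : Measure (EuclideanSpace ℝ (Fin m)))
        (fun f => Laplacian.laplacian^[N] f) 0 =
      (2 / sphereArea m) ^ (p⁻¹).toReal *
        sharpConstant (evenTypeClass 1 ∩ lpClass p (powerWeight (m - 1)))
          p (powerWeight (m - 1))
          (fun g => (besselOp ((m : ℝ) / 2 - 1))^[N] g) 0 := by
  have : NeZero m := ⟨by omega⟩
  have hdim : Module.finrank ℝ (EuclideanSpace ℝ (Fin m)) = m := by simp
  have hA0 : sphereArea m ≠ 0 := Measure.measure_univ_ne_zero.2 (Measure.toSphere_ne_zero _)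
  have hAt : sphereArea m ≠ ∞ := measure_ne_top _ _
  have hq : 0 ≤ (p⁻¹).toReal := ENNReal.toReal_nonneg
  set κ := (2 / sphereArea m) ^ (p⁻¹).toReal with hκ
  have hκinv : (sphereArea m / 2) ^ (p⁻¹).toReal = κ⁻¹ := by
    rw [hκ, ← ENNReal.inv_rpow, ENNReal.inv_div (Or.inl hAt) (Or.inl hA0)]
  have hκ0 : κ ≠ 0 := by
    simp [hκ, ENNReal.rpow_eq_zero_iff, ENNReal.div_eq_top, hA0, hAt]
  have hκt : κ ≠ ∞ := by
    refine ENNReal.rpow_ne_top_of_nonneg hq ?_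
    simp [ENNReal.div_eq_top, hA0]
  have hB : ∀ {f : EuclideanSpace ℝ (Fin m) → ℂ}, f ∈ sphericalTypeClass 1 m →
      (besselOp ((m : ℝ) / 2 - 1))^[N] (sphereMean f) 0 =
        (Laplacian.laplacian^[N] f : EuclideanSpace ℝ (Fin m) → ℂ) 0 := fun hf => by
    simpa only [hdim] using
      iterate_besselOp_sphereMean_zero N (contDiff_of_mem_sphericalTypeClass hf)
  refine le_antisymm ?_ ?_
  · refine iSup₂_le fun f ⟨⟨hf, hfp⟩, hf0⟩ => ?_
    have hle := eLpNorm_sphereMean_le hp (contDiff_of_mem_sphericalTypeClass hf).continuous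
    rw [hdim] at hle
    change _ ≤ κ * _ at hle
    -- If the mean vanishes it is not admissible on the right, but then `Δ^N f(0) = 0`.
    rcases eq_or_ne (sphereMean f) 0 with h0 | h0
    · have : (Laplacian.laplacian^[N] f : EuclideanSpace ℝ (Fin m) → ℂ) 0 = 0 := by
        have hz : sphereMean (0 : EuclideanSpace ℝ (Fin m) → ℂ) = 0 := by
          funext t
          simp [sphereMean, average]
        have hmem : (0 : EuclideanSpace ℝ (Fin m) → ℂ) ∈ sphericalTypeClass 1 m :=
          ⟨0, ⟨differentiable_const 0, fun ε _ => ⟨0, by simp⟩⟩, by simp⟩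
        rw [← hB hf, h0, ← hz, hB hmem, Function.iterate_fixed]
        · rfl
        · exact InnerProductSpace.laplacian_const (c := (0 : ℂ))
      simp [this]
    have hmem : sphereMean f ∈
        (evenTypeClass 1 ∩ lpClass p (powerWeight (m - 1))) \ {0} := by
      refine ⟨⟨sphereMean_mem_evenTypeClass hf, ?_, ?_⟩, h0⟩
      · exact (continuous_sphereMean
          (contDiff_of_mem_sphericalTypeClass hf).continuous).aestronglyMeasurable
      · exact hle.trans_lt (ENNReal.mul_lt_top hκt.lt_top hfp.2)
    refine le_trans ?_ (mul_le_mul_right (le_iSup₂ (f := fun g (_ : g ∈ (evenTypeClass 1 ∩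
      lpClass p (powerWeight (m - 1))) \ {0}) => ‖(besselOp ((m : ℝ) / 2 - 1))^[N] g 0‖ₑ /
        eLpNorm g p (powerWeight (m - 1))) _ hmem) κ)
    rw [hB hf]
    calc _ = κ * (_ / (κ * eLpNorm f p volume)) := by
          rw [← mul_div_assoc, ENNReal.mul_div_mul_left _ _ hκ0 hκt]
      _ ≤ _ := by gcongr
  · rw [sharpConstant, ENNReal.mul_iSup]
    refine iSup_le fun g => ?_
    rw [ENNReal.mul_iSup]
    refine iSup_le fun ⟨⟨hg, hgp⟩, hg0⟩ => ?_
    set f : EuclideanSpace ℝ (Fin m) → ℂ := fun x => g ‖x‖ with hf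
    have hfm : f ∈ sphericalTypeClass 1 m := comp_norm_mem_sphericalTypeClass zero_le_one hg
    have heven := even_of_mem_evenTypeClass hg
    have hgf : sphereMean f = g := sphereMean_comp_norm heven
    have hn : eLpNorm f p volume = κ⁻¹ * eLpNorm g p (powerWeight (m - 1)) := by
      have h := eLpNorm_comp_norm (E := EuclideanSpace ℝ (Fin m)) p
        (continuous_of_mem_evenTypeClass hg) heven
      rw [hdim] at h
      rw [← hκinv]
      exact h
    have hmem : f ∈ (sphericalTypeClass 1 m ∩ lpClass p volume) \ {0} := by
      refine ⟨⟨hfm, (contDiff_of_mem_sphericalTypeClass hfm).continuous.aestronglyMeasurable, ?_⟩,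
        fun h0 => hg0 ?_⟩
      · rw [hn]
        exact ENNReal.mul_lt_top (ENNReal.inv_lt_top.2 hκ0.bot_lt) hgp.2
      · rw [Set.mem_singleton_iff] at h0 ⊢
        rw [← hgf, h0]
        funext t
        simp [sphereMean, average]
    refine le_trans (le_of_eq ?_) (le_iSup₂ (f := fun f (_ : f ∈ (sphericalTypeClass 1 m ∩
      lpClass p volume) \ {0}) => ‖(Laplacian.laplacian^[N] f : EuclideanSpace ℝ (Fin m) → ℂ) 0‖ₑ /
        eLpNorm f p volume) _ hmem)
    rw [← hB hfm, hgf, hn, ← mul_div_assoc, ← ENNReal.mul_div_mul_left _ _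
      (ENNReal.inv_ne_zero.2 hκt) (ENNReal.inv_ne_top.2 hκ0), ← mul_assoc,
      ENNReal.inv_mul_cancel hκ0 hκt, one_mul]
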